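/- Let $\mathbb{B}$ be the algebra of biquaternions $a_0+a_1I+a_2J+a_3K$ with $a_\mu\in\mathbb{C}$, where $I^2=J^2=K^2=IJK=-1$ and the complex unit $i$ is central. On $\mathbb{R}^4$ with coordinates $(t,x,y,z)$ put $q=t+i(xI+yJ+zK)$, and consider the $\mathbb{B}$-valued forms $$S_H=dx\wedge dy\wedge dz-i\,(I\,dt\wedge dy\wedge dz+J\,dt\wedge dz\wedge dx+K\,dt\wedge dx\wedge dy),\qquad V_H=dt\wedge dx\wedge dy\wedge dz .$$ For $f$ with values in $\mathbb{B}$ let $D_Hf=\partial_tf+i(I\,\partial_xf+J\,\partial_yf+K\,\partial_zf)$; call $f$ biregular on a set if at each of its points $f$ is (real) differentiable and $D_Hf=0$. In wedge products the coefficients are multiplied in $\mathbb{B}$ in the order written. 1. $S_H$ is closed: $dS_H=0$. 2. If $f$ is differentiable at a point, then at this point $$S_H\wedge df=-V_H\,D_Hf,$$ and the exterior derivative (with the usual sign convention, $d(h\,\omega)=dh\wedge\omega+h\,d\omega$ for scalar functions $h$) of the 3-form $S_Hf$ is $d(S_Hf)=V_H\,D_Hf$. Equivalently $d(S_Hf)=-V_HD_Hf$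 in the convention in which the differential is put on the right, $d(S_Hf)=S_H\wedge df$. 3. Let $U\subseteq\mathbb{R}^4$ be open and $f:U\to\mathbb{B}$ differentiable. Then $f$ is biregular on $U$ if and only if there is a function $g:U\to\mathbb{B}$ with $$\tfrac12\,d(dq\wedge dq\,f)=S_H\,g\quad\text{on }U .$$ 4. Let $V\subset\mathbb{R}^4$ be a compact region with piecewise smooth boundary, that is, a compact domain with corners: near each of its points $V$ is carried onto a relatively open part of $[0,\infty)^4$ by an orientation-preserving $C^2$ diffeomorphism between open subsets of $\mathbb{R}^4$. If $f$ is continuously differentiable on an open set containing $V$ and biregular on $V$ (that is, within and on the boundary), then $$\oint_{\partial V}S_H\,f=0 .$$ Here $\partial V$ has the induced (outward normal first) orientation, and the integral is computed as usual in a finite atlas of such charts with a subordinate $C^1$ partition of unity; such an atlas exists, and the integral vanishes for every choice of it. -/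

import Mathlib

open scoped Quaternion Topology

noncomputable section

namespace Biquat

/-- Biquaternions: quaternions with complex components, i.e. the algebra over `ℂ` with basis
`1, I, J, K` and `I² = J² = K² = IJK = -1`. -/
abbrev B : Type := ℍ[ℂ,-1,-1]

/-- Spacetime `ℝ⁴` with coordinates `(t, x, y, z) = (q 0, q 1, q 2, q 3)`. -/
abbrev Spacetime : Type := Fin 4 → ℝ

/-- `B` is finite-dimensional; it carries the norm of its coordinate space `ℂ⁴` (any other norm
gives the same derivatives and integrals). -/
instance : NormedAddCommGroup B :=
  NormedAddCommGroup.induced B (Fin 4 → ℂ)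
    (QuaternionAlgebra.linearEquivTuple (-1 : ℂ) 0 (-1)).toAddEquiv
    (QuaternionAlgebra.linearEquivTuple (-1 : ℂ) 0 (-1)).injective

instance : NormedSpace ℝ B :=
  NormedSpace.induced ℝ B (Fin 4 → ℂ)
    ((QuaternionAlgebra.linearEquivTuple (-1 : ℂ) 0 (-1)).toLinearMap.restrictScalars ℝ)

instance : FiniteDimensional ℝ B :=
  FiniteDimensional.of_injective
    ((QuaternionAlgebra.linearEquivTuple (-1 : ℂ) 0 (-1)).toLinearMap.restrictScalars ℝ)
    (QuaternionAlgebra.linearEquivTuple (-1 : ℂ) 0 (-1)).injective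

/-- The central imaginary unit `i` of the complex coefficients. -/
def im : B := ⟨Complex.I, 0, 0, 0⟩

/-- The basis quaternion `I`. -/
def qI : B := ⟨0, 1, 0, 0⟩

/-- The basis quaternion `J`. -/
def qJ : B := ⟨0, 0, 1, 0⟩

/-- The basis quaternion `K`. -/
def qK : B := ⟨0, 0, 0, 1⟩

/-! ### Biquaternion-valued alternating forms -/

/-- Biquaternion-valued alternating `n`-forms on `ℝ⁴`. -/
abbrev Form (n : ℕ) : Type := Spacetime [⋀^Fin n]→L[ℝ] B

/-- The form `c ω`, with the constant `c` on the left. -/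
def lmul {n : ℕ} (c : B) (ω : Form n) : Form n :=
  (LinearMap.toContinuousLinearMap (LinearMap.mulLeft ℝ c)).compContinuousAlternatingMap ω

/-- The form `ω c`, with the constant `c` on the right. -/
def rmul {n : ℕ} (ω : Form n) (c : B) : Form n :=
  (LinearMap.toContinuousLinearMap (LinearMap.mulRight ℝ c)).compContinuousAlternatingMap ω

@[simp] theorem lmul_apply {n : ℕ} (c : B) (ω : Form n) (v : Fin n → Spacetime) :
    lmul c ω v = c * ω v := rfl

@[simp] theorem rmul_apply {n : ℕ} (ω : Form n) (c : B) (v : Fin n → Spacetime) :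
    rmul ω c v = ω v * c := rfl

/-- A linear map `ℝ⁴ → B`, regarded as a 1-form. -/
def oneForm (α : Spacetime →L[ℝ] B) : Form 1 :=
  ContinuousAlternatingMap.ofSubsingleton ℝ Spacetime B (0 : Fin 1) α

/-- The wedge product `α ∧ ω` of a 1-form and an `n`-form, the values being multiplied in `B` in
this order: `(α ∧ ω)(v₀, …, vₙ) = ∑ᵢ (-1)ⁱ α(vᵢ) ω(v₀, …, v̂ᵢ, …, vₙ)`. -/
def wedge {n : ℕ} (α : Spacetime →L[ℝ] B) (ω : Form n) : Form (n + 1) :=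
  ContinuousAlternatingMap.alternatizeUncurryFin <| LinearMap.toContinuousLinearMap
    { toFun := fun v => lmul (α v) ω
      map_add' := fun v w => by ext1 u; simp [add_mul]
      map_smul' := fun r v => by ext1 u; simp }

/-- The wedge product `ω ∧ α` of an `n`-form and a 1-form, the values being multiplied in `B` in
this order: `(ω ∧ α)(v₀, …, vₙ) = ∑ᵢ (-1)ⁿ⁻ⁱ ω(v₀, …, v̂ᵢ, …, vₙ) α(vᵢ)`. -/
def wedgeRight {n : ℕ} (ω : Form n) (α : Spacetime →L[ℝ] B) : Form (n + 1) :=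
  (-1 : ℝ) ^ n • (ContinuousAlternatingMap.alternatizeUncurryFin <|
    LinearMap.toContinuousLinearMap
      { toFun := fun v => rmul ω (α v)
        map_add' := fun v w => by ext1 u; simp [mul_add]
        map_smul' := fun r v => by ext1 u; simp })

/-- The coordinate 1-forms `dt, dx, dy, dz` (for `μ = 0, 1, 2, 3`), with values in the real
scalars of `B`. -/
def dcoord (μ : Fin 4) : Spacetime →L[ℝ] B :=
  (ContinuousLinearMap.proj (R := ℝ) (φ := fun _ : Fin 4 => ℝ) μ).smulRight (1 : B)

/-- The position biquaternion `q = t + i (x I + y J + z K)`. -/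
def position (p : Spacetime) : B :=
  p 0 • (1 : B) + im * (p 1 • qI + p 2 • qJ + p 3 • qK)

/-- The 1-form `dq`. -/
def dq (p : Spacetime) : Spacetime →L[ℝ] B := fderiv ℝ position p

/-- `dq ∧ dq`. -/
def dqdq (p : Spacetime) : Form 2 := wedge (dq p) (oneForm (dq p))

/-- `dx_μ ∧ dx_ν ∧ dx_κ`. -/
def d3 (μ ν κ : Fin 4) : Form 3 := wedge (dcoord μ) (wedge (dcoord ν) (oneForm (dcoord κ)))

/-- `S_H = dx ∧ dy ∧ dz - i (I dt ∧ dy ∧ dz + J dt ∧ dz ∧ dx + K dt ∧ dx ∧ dy)`. -/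
def SH : Form 3 :=
  d3 1 2 3 - lmul im (lmul qI (d3 0 2 3) + lmul qJ (d3 0 3 1) + lmul qK (d3 0 1 2))

/-- `V_H = dt ∧ dx ∧ dy ∧ dz`. -/
def VH : Form 4 := wedge (dcoord 0) (d3 1 2 3)

/-! ### Biregular functions -/

/-- The partial derivative `∂f / ∂x_μ`. -/
def pd (μ : Fin 4) (f : Spacetime → B) (p : Spacetime) : B := fderiv ℝ f p (Pi.single μ 1)

/-- `D_H f = ∂ₜ f + i (I ∂ₓ f + J ∂ᵧ f + K ∂_z f)`. -/
def DH (f : Spacetime → B) (p : Spacetime) : B :=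
  pd 0 f p + im * (qI * pd 1 f p + qJ * pd 2 f p + qK * pd 3 f p)

/-- `f` is biregular on `S`: it is differentiable with `D_H f = 0` at every point of `S`. -/
def IsBiregularOn (f : Spacetime → B) (S : Set Spacetime) : Prop :=
  ∀ p ∈ S, DifferentiableAt ℝ f p ∧ DH f p = 0

/-! ### Regions with piecewise smooth boundary and integrals over their boundaries -/

/-- A positively oriented `C²` chart of `ℝ⁴` in which `V` is the corner `{y | ∀ j, 0 ≤ y j}`. -/
structure CornerChart (V : Set Spacetime) where
  /-- The underlying homeomorphism between open subsets of `ℝ⁴`. -/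
  chart : OpenPartialHomeomorph Spacetime Spacetime
  contDiffOn : ContDiffOn ℝ 2 chart chart.source
  contDiffOn_symm : ContDiffOn ℝ 2 chart.symm chart.target
  det_pos : ∀ p ∈ chart.source, 0 < (fderiv ℝ chart p).det
  mem_iff : ∀ p ∈ chart.source, p ∈ V ↔ ∀ j, 0 ≤ chart p j

/-- `V` is a compact region with piecewise smooth boundary: a compact domain with corners in `ℝ⁴`.
(At an interior point of `V`, the image of the chart lies in the open corner; at a smooth boundary
point only one coordinate vanishes.) -/
def IsRegion (V : Set Spacetime) : Prop :=
  IsCompact V ∧ ∀ p ∈ V, ∃ c : CornerChart V, p ∈ c.chart.source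

/-- A finite oriented atlas of `V` with a subordinate partition of unity. -/
structure RegionAtlas (V : Set Spacetime) where
  /-- The number of charts. -/
  N : ℕ
  /-- The charts. -/
  c : Fin N → CornerChart V
  /-- The partition of unity. -/
  ρ : Fin N → Spacetime → ℝ
  contDiff : ∀ i, ContDiff ℝ 1 (ρ i)
  nonneg : ∀ i p, 0 ≤ ρ i p
  hasCompactSupport : ∀ i, HasCompactSupport (ρ i)
  tsupport_subset : ∀ i, tsupport (ρ i) ⊆ (c i).chart.source
  sum_eq_one : ∀ᶠ p in 𝓝ˢ V, ∑ i, ρ i p = 1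

open Classical in
/-- The coefficient, with respect to `dy₀ ∧ … ∧ dyⱼ₋₁ ∧ dyⱼ₊₁ ∧ … ∧ dy₃`, of the pullback of the
3-form `ω` by the inverse of a chart `Φ`, extended by zero from the image of `Φ`. -/
def pullbackCoeff (Φ : OpenPartialHomeomorph Spacetime Spacetime) (ω : Spacetime → Form 3)
    (j : Fin 4) (y : Spacetime) : B :=
  if y ∈ Φ.target then
    ω (Φ.symm y) (fun k : Fin 3 => fderiv ℝ Φ.symm y (Pi.single (j.succAbove k) 1))
  else 0

/-- The integral `∮_{∂V} ω` of a 3-form over the boundary of `V` with its induced (outward normal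
first) orientation, computed in an atlas with a partition of unity. In the corner
`{y | ∀ j, 0 ≤ y j}` the face `yⱼ = 0` has outward normal `-eⱼ`, hence the sign `(-1)^(j+1)` with
respect to `dy₀ ∧ … ∧ dyⱼ₋₁ ∧ dyⱼ₊₁ ∧ … ∧ dy₃`. -/
def RegionAtlas.boundaryIntegral {V : Set Spacetime} (A : RegionAtlas V)
    (ω : Spacetime → Form 3) : B :=
  ∑ i, ∑ j : Fin 4, (-1 : ℝ) ^ ((j : ℕ) + 1) •
    ∫ u in {u : Fin 3 → ℝ | ∀ k, 0 ≤ u k},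
      pullbackCoeff (A.c i).chart (fun p => A.ρ i p • ω p) j (j.insertNth (0 : ℝ) u)

end Biquat

end

noncomputable section

namespace Biquat

open MeasureTheory

/-! The algebraic claims are checked on basis vectors: a 4-form is determined by its value on (e₀,
…, e₃), a 3-form by its four values with one eⱼ omitted. On these, (-1)ʲ S_H takes the values 1, iI,
iJ, iK, exactly the coefficients of D_H; hence d(S_H f) = V_H D_H f, and S_H ∧ df differs by the
sign (-1)³.

The form ½ dq ∧ dq has constant coefficients, namely halved commutators of 1, iI, iJ, iK. Comparing
components, ½ d(dq ∧ dq f) = S_H g says g = -(I ∂ₓf + J ∂ᵧf + K ∂_z f) (dx ∧ dy ∧ dz component) and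
g = -i ∂ₜf (each of the other three). Such a g exists iff the two agree, which is D_H f = 0
multiplied by i.

The integral theorem is Stokes: a partition of unity localizes to corner charts, pullback moves each
piece to the orthant, and the divergence theorem on a large box finishes
(`sum_faces_eq_integral_extDeriv`). The integrand V_H D_H f vanishes on V. -/

/-- The standard basis vectors of `ℝ⁴`. -/
abbrev stdVec (μ : Fin 4) : Spacetime := Pi.single μ 1

/-! ### Alternating forms tested on basis vectors -/

theorem form_four_ext {ω η : Form 4} (h : ω stdVec = η stdVec) : ω = η := by
  apply ContinuousAlternatingMap.toAlternatingMap_injective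
  refine Module.Basis.ext_alternating (Pi.basisFun ℝ (Fin 4)) fun v hv => ?_
  let σ : Equiv.Perm (Fin 4) := Equiv.ofBijective v (Finite.injective_iff_bijective.1 hv)
  have hσ : (fun i => Pi.basisFun ℝ (Fin 4) (v i)) = stdVec ∘ σ := by
    funext i; simp [σ]
  rw [hσ, AlternatingMap.map_perm, AlternatingMap.map_perm]
  exact congrArg _ h

/-- An injective triple of indices misses some j, so it is a permutation of the increasing triple
omitting j, and permuting costs only a sign. -/
theorem form_three_ext {ω η : Form 3}
    (h : ∀ j : Fin 4, ω (j.removeNth stdVec) = η (j.removeNth stdVec)) : ω = η := by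
  apply ContinuousAlternatingMap.toAlternatingMap_injective
  refine Module.Basis.ext_alternating (Pi.basisFun ℝ (Fin 4)) fun v hv => ?_
  obtain ⟨j, hj⟩ : ∃ j, ∀ k, v k ≠ j := by
    by_contra! hsurj
    simpa using Fintype.card_le_of_surjective v hsurj
  choose s hs using fun k => Fin.exists_succAbove_eq (hj k)
  have hs_inj : Function.Injective s := fun a b hab => hv (by rw [← hs a, ← hs b, hab])
  let σ : Equiv.Perm (Fin 3) := Equiv.ofBijective s (Finite.injective_iff_bijective.1 hs_inj)
  have hσ : (fun i => Pi.basisFun ℝ (Fin 4) (v i)) = j.removeNth stdVec ∘ σ := by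
    funext i; simp [σ, hs, Fin.removeNth]
  rw [hσ, AlternatingMap.map_perm, AlternatingMap.map_perm]
  exact congrArg _ (h j)

theorem wedge_apply {n : ℕ} (α : Spacetime →L[ℝ] B) (ω : Form n) (v : Fin (n + 1) → Spacetime) :
    wedge α ω v = ∑ i, (-1) ^ i.val • (α (v i) * ω (i.removeNth v)) := by
  simp [wedge, ContinuousAlternatingMap.alternatizeUncurryFin_apply]

theorem wedgeRight_apply {n : ℕ} (ω : Form n) (α : Spacetime →L[ℝ] B)
    (v : Fin (n + 1) → Spacetime) :
    wedgeRight ω α v = (-1 : ℝ) ^ n • ∑ i, (-1) ^ i.val • (ω (i.removeNth v) * α (v i)) := by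
  simp [wedgeRight, ContinuousAlternatingMap.alternatizeUncurryFin_apply]

theorem d3_apply (μ ν κ : Fin 4) (v : Fin 3 → Spacetime) :
    d3 μ ν κ v = ((v 0 μ * (v 1 ν * v 2 κ - v 2 ν * v 1 κ) - v 1 μ * (v 0 ν * v 2 κ - v 2 ν * v 0 κ)
      + v 2 μ * (v 0 ν * v 1 κ - v 1 ν * v 0 κ) : ℝ)) • (1 : B) := by
  simp [d3, wedge_apply, oneForm, dcoord, Fin.sum_univ_succ, Fin.removeNth, Fin.succAbove]
  module

theorem SH_removeNth (j : Fin 4) :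
    SH (j.removeNth stdVec) = ![1, -(im * qI), im * qJ, -(im * qK)] j := by
  fin_cases j <;> simp [SH, d3_apply, Fin.removeNth, Fin.tail, Fin.succAbove]

theorem VH_stdVec : VH stdVec = 1 := by
  simp [VH, wedge_apply, Fin.sum_univ_succ, d3_apply, dcoord, Fin.removeNth, Fin.succAbove]

/-! ### The exterior derivative of `S_H f` -/

/-- `ω c` as a linear function of the constant `c`. -/
def rmulCLM {n : ℕ} (ω : Form n) : B →L[ℝ] Form n :=
  LinearMap.toContinuousLinearMap
    { toFun := fun c => rmul ω c
      map_add' := fun c d => by ext1 v; simp [mul_add]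
      map_smul' := fun r c => by ext1 v; simp }

theorem extDeriv_rmul_apply {n : ℕ} (ω : Form n) {f : Spacetime → B} {p : Spacetime}
    (hf : DifferentiableAt ℝ f p) (v : Fin (n + 1) → Spacetime) :
    extDeriv (fun p => rmul ω (f p)) p v =
      ∑ i, (-1) ^ i.val • (ω (i.removeNth v) * fderiv ℝ f p (v i)) := by
  have h : HasFDerivAt (fun p => rmul ω (f p)) ((rmulCLM ω).comp (fderiv ℝ f p)) p :=
    (rmulCLM ω).hasFDerivAt.comp p hf.hasFDerivAt
  rw [extDeriv, h.fderiv, ContinuousAlternatingMap.alternatizeUncurryFin_apply]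
  rfl

theorem extDeriv_rmul_SH {f : Spacetime → B} {p : Spacetime} (hf : DifferentiableAt ℝ f p) :
    extDeriv (fun p => rmul SH (f p)) p = rmul VH (DH f p) := by
  refine form_four_ext ?_
  rw [extDeriv_rmul_apply SH hf, rmul_apply, VH_stdVec]
  refine (Fin.sum_univ_four _).trans ?_
  simp only [SH_removeNth, DH, pd]
  simp [mul_add, ← mul_assoc]
  abel

theorem wedgeRight_SH_fderiv (f : Spacetime → B) (p : Spacetime) :
    wedgeRight SH (fderiv ℝ f p) = -rmul VH (DH f p) := by
  refine form_four_ext ?_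
  rw [wedgeRight_apply, ContinuousAlternatingMap.neg_apply, rmul_apply, VH_stdVec]
  refine (congrArg _ (Fin.sum_univ_four _)).trans ?_
  simp only [SH_removeNth, DH, pd]
  simp [mul_add, ← mul_assoc, pow_succ]
  abel

/-! ### The form `dq ∧ dq` and biregularity -/

/-- The position biquaternion as a linear map. -/
def positionLM : Spacetime →ₗ[ℝ] B where
  toFun := position
  map_add' p q := by simp only [position, Pi.add_apply, add_smul, mul_add]; abel
  map_smul' r p := by simp [position, mul_smul, ← smul_add]

theorem hasFDerivAt_position (p : Spacetime) :
    HasFDerivAt position (LinearMap.toContinuousLinearMap positionLM) p :=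
  (LinearMap.toContinuousLinearMap positionLM).hasFDerivAt

theorem dq_stdVec (p : Spacetime) (μ : Fin 4) :
    dq p (stdVec μ) = ![1, im * qI, im * qJ, im * qK] μ := by
  rw [dq, (hasFDerivAt_position p).fderiv]
  fin_cases μ <;> simp [positionLM, position]

theorem dqdq_stdVec (p : Spacetime) (μ ν : Fin 4) :
    dqdq p ![stdVec μ, stdVec ν] =
      dq p (stdVec μ) * dq p (stdVec ν) - dq p (stdVec ν) * dq p (stdVec μ) := by
  simp [dqdq, wedge_apply, oneForm, Fin.removeNth, sub_eq_add_neg, Fin.succAbove]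

/-- As `position` is linear, dq ∧ dq is a constant form, so differentiating dq ∧ dq f only
differentiates f. -/
theorem dqdq_eq (p q : Spacetime) : dqdq p = dqdq q := by
  simp only [dqdq, dq, (hasFDerivAt_position _).fderiv]

theorem im_mul_im : im * im = -1 := by ext <;> simp [im]

theorem im_mul_mul_im_mul (c x : B) : im * c * (im * x) = -(c * x) := by
  have hc : c * im = im * c := by ext <;> simp [im, mul_comm]
  rw [← mul_assoc, mul_assoc im c im, hc, ← mul_assoc im, im_mul_im, neg_one_mul, neg_mul]

/-- The four components of `½ d(dq ∧ dq f) = S_H g`. -/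
theorem half_extDeriv_dqdq_eq_iff {f : Spacetime → B} {p : Spacetime}
    (hf : DifferentiableAt ℝ f p) (b : B) :
    (1 / 2 : ℝ) • extDeriv (fun p => rmul (dqdq p) (f p)) p = rmul SH b ↔
      b = -(qI * pd 1 f p + qJ * pd 2 f p + qK * pd 3 f p) ∧ b = -(im * pd 0 f p) := by
  -- Since i² = -1, these are the negated commutators of I, J, K; their factor 2 is what the ½ in
  -- the statement cancels.
  have hI : im * qI * (im * qJ) - im * qJ * (im * qI) = (-2 : ℝ) • qK := by
    (ext <;> simp [im, qI, qJ, qK]); norm_num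
  have hJ : im * qI * (im * qK) - im * qK * (im * qI) = (2 : ℝ) • qJ := by
    (ext <;> simp [im, qI, qJ, qK]); norm_num
  have hK : im * qJ * (im * qK) - im * qK * (im * qJ) = (-2 : ℝ) • qI := by
    (ext <;> simp [im, qI, qJ, qK]); norm_num
  have hpair : ∀ (j : Fin 4) (i : Fin 3), i.removeNth (j.removeNth stdVec) =
      ![stdVec (j.succAbove (i.succAbove 0)), stdVec (j.succAbove (i.succAbove 1))] := by
    intro j i; ext k; fin_cases k <;> rfl
  have key : ∀ j : Fin 4, extDeriv (fun p => rmul (dqdq p) (f p)) p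
      (j.removeNth stdVec) = (2 : ℝ) • ![-(qI * pd 1 f p + qJ * pd 2 f p + qK * pd 3 f p), -(qI * pd 0 f p),
        qJ * pd 0 f p, -(qK * pd 0 f p)] j := by
    intro j
    have hc : (fun x => rmul (dqdq x) (f x)) = fun x => rmul (dqdq p) (f x) := by
      funext x; rw [dqdq_eq x p]
    rw [hc, extDeriv_rmul_apply _ hf]
    refine (Fin.sum_univ_three _).trans ?_
    simp only [hpair, dqdq_stdVec, dq_stdVec, Fin.removeNth_apply]
    fin_cases j <;> simp [Fin.succAbove, hI, hJ, hK, pd]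
    all_goals module
  have hSH : ∀ j : Fin 4, ((1 / 2 : ℝ) • extDeriv (fun p => rmul (dqdq p) (f p)) p)
      (j.removeNth stdVec) = rmul SH b (j.removeNth stdVec) ↔
      ![-(qI * pd 1 f p + qJ * pd 2 f p + qK * pd 3 f p), -(qI * pd 0 f p),
        qJ * pd 0 f p, -(qK * pd 0 f p)] j =
      ![1, -(im * qI), im * qJ, -(im * qK)] j * b := by
    intro j
    rw [ContinuousAlternatingMap.smul_apply, key, rmul_apply, smul_smul, SH_removeNth]
    norm_num
  constructor
  · intro h
    have h0 := (hSH 0).1 (DFunLike.congr_fun h _)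
    have h1 := (hSH 1).1 (DFunLike.congr_fun h _)
    refine ⟨by simpa using h0.symm, ?_⟩
    -- Multiplying by iI on the left isolates b, because (iI)² = 1.
    have h2 : im * qI * -(qI * pd 0 f p) = im * qI * (-(im * qI) * b) := congrArg _ h1
    have hII : qI * qI = -1 := by ext <;> simp [qI]
    rw [neg_mul, mul_neg, mul_neg, neg_inj, mul_assoc im qI b, im_mul_mul_im_mul, mul_assoc im,
      ← mul_assoc qI, ← mul_assoc qI, hII, neg_one_mul, neg_one_mul, neg_neg] at h2
    rw [← h2, mul_neg]
  · rintro ⟨h0, h1⟩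
    refine form_three_ext fun j => (hSH j).2 ?_
    fin_cases j
    · simp [h0]
    all_goals simp [h1, im_mul_mul_im_mul]

theorem isBiregularOn_iff_exists {U : Set Spacetime} {f : Spacetime → B} (hU : IsOpen U)
    (hf : DifferentiableOn ℝ f U) :
    IsBiregularOn f U ↔ ∃ g : Spacetime → B, ∀ p ∈ U,
      (1 / 2 : ℝ) • extDeriv (fun p => rmul (dqdq p) (f p)) p = rmul SH (g p) := by
  have hf' : ∀ p ∈ U, DifferentiableAt ℝ f p := fun p hp => hf.differentiableAt (hU.mem_nhds hp)
  have hDH : ∀ p, DH f p = 0 ↔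
      im * pd 0 f p = qI * pd 1 f p + qJ * pd 2 f p + qK * pd 3 f p := by
    intro p
    rw [DH]
    generalize qI * pd 1 f p + qJ * pd 2 f p + qK * pd 3 f p = s
    generalize pd 0 f p = a
    constructor
    · intro h
      rw [eq_neg_of_add_eq_zero_left h, mul_neg, ← mul_assoc, im_mul_im, neg_one_mul, neg_neg]
    · rintro rfl
      rw [← mul_assoc, im_mul_im, neg_one_mul, add_neg_cancel]
  constructor
  · intro h
    refine ⟨fun p => -(im * pd 0 f p), fun p hp => ?_⟩
    refine (half_extDeriv_dqdq_eq_iff (hf' p hp) _).2 ⟨?_, rfl⟩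
    exact congrArg Neg.neg ((hDH p).1 (h p hp).2)
  · rintro ⟨g, hg⟩ p hp
    obtain ⟨h0, h1⟩ := (half_extDeriv_dqdq_eq_iff (hf' p hp) _).1 (hg p hp)
    exact ⟨hf' p hp, (hDH p).2 (neg_inj.1 (h1.symm.trans h0))⟩

/-! ### Stokes' theorem on the orthant -/

theorem sum_faces_eq_integral_extDeriv {η : Spacetime → Form 3} (hd : Differentiable ℝ η)
    (hc : HasCompactSupport η) (hcont : Continuous fun y => extDeriv η y stdVec) :
    ∑ j : Fin 4, (-1 : ℝ) ^ ((j : ℕ) + 1) • ∫ u in {u : Fin 3 → ℝ | ∀ k, 0 ≤ u k},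
        η (j.insertNth (0 : ℝ) u) (j.removeNth stdVec) =
      ∫ y in {y : Spacetime | ∀ j, 0 ≤ y j}, extDeriv η y stdVec := by
  obtain ⟨R, hR0, hR⟩ := hc.isCompact.isBounded.subset_ball_lt 0 0
  have hzero : ∀ y : Spacetime, ∀ j, R ≤ y j → y ∉ tsupport η := fun y j hj hy => by
    have h1 : ‖y‖ < R := by simpa using hR hy
    exact absurd ((hj.trans (le_abs_self _)).trans (norm_le_pi_norm y j)) (not_le.2 h1)
  have hη0 : ∀ y, y ∉ tsupport η → η y = 0 := fun y hy => image_eq_zero_of_notMem_tsupport hy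
  have hdη0 : ∀ y, y ∉ tsupport η → extDeriv η y stdVec = 0 := fun y hy => by
    rw [extDeriv, fderiv_of_notMem_tsupport ℝ hy]
    exact DFunLike.congr_fun
      (map_zero (ContinuousAlternatingMap.alternatizeUncurryFinCLM ℝ Spacetime B)) stdVec
  -- With these signs the components of η form a vector field whose divergence is the coefficient of
  -- dη.
  let f : Fin 4 → Spacetime → B := fun j y => (-1 : ℝ) ^ (j : ℕ) • η y (j.removeNth stdVec)
  have happ : ∀ j : Fin 4, Differentiable ℝ fun y => η y (j.removeNth stdVec) := fun j =>
    (ContinuousAlternatingMap.apply ℝ Spacetime B (j.removeNth stdVec)).differentiable.comp hd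
  have hf : ∀ j, Differentiable ℝ (f j) := fun j => (happ j).fun_const_smul _
  have hdiv : ∀ y, ∑ j, fderiv ℝ (f j) y (stdVec j) = extDeriv η y stdVec := by
    intro y
    rw [extDeriv_apply (hd y)]
    refine Finset.sum_congr rfl fun j _ => ?_
    change fderiv ℝ (fun y => (-1 : ℝ) ^ (j : ℕ) • η y (j.removeNth stdVec)) y _ = _
    rw [fderiv_fun_const_smul (happ j y), smul_apply]
    rcases Nat.even_or_odd (j : ℕ) with h | h <;> simp [h.neg_one_pow]
  have hcube : ∀ {n : ℕ}, Set.Icc (0 : Fin n → ℝ) (fun _ => R) ⊆ {u | ∀ k, 0 ≤ u k} := by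
    intro n u hu
    exact hu.1
  have hmeas : ∀ n : ℕ, MeasurableSet {u : Fin n → ℝ | ∀ k, 0 ≤ u k} := fun n =>
    (isClosed_Ici (a := (0 : Fin n → ℝ))).measurableSet
  have key := integral_divergence_of_hasFDerivAt_off_countable' (0 : Spacetime) (fun _ => R)
    (fun _ => hR0.le) f (fun j y => fderiv ℝ (f j) y) ∅ Set.countable_empty
    (fun j => (hf j).continuous.continuousOn) (fun y _ j => (hf j y).hasFDerivAt)
    (by simpa only [hdiv] using hcont.continuousOn.integrableOn_compact isCompact_Icc)
  simp only [hdiv] at key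
  have hbox : ∫ y in {y : Spacetime | ∀ j, 0 ≤ y j}, extDeriv η y stdVec =
      ∫ y in Set.Icc (0 : Spacetime) (fun _ => R), extDeriv η y stdVec := by
    refine setIntegral_eq_of_subset_of_forall_sdiff_eq_zero (hmeas 4) hcube fun y hy => ?_
    obtain ⟨j, hj⟩ : ∃ j, R < y j := by
      by_contra! h
      exact hy.2 ⟨hy.1, h⟩
    exact hdη0 y (hzero y j hj.le)
  rw [hbox, key]
  refine Finset.sum_congr rfl fun j _ => ?_
  have hface : ∫ u in {u : Fin 3 → ℝ | ∀ k, 0 ≤ u k}, η (j.insertNth (0 : ℝ) u) (j.removeNth stdVec) =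
      ∫ u in Set.Icc (0 : Fin 3 → ℝ) (fun _ => R),
        η (j.insertNth (0 : ℝ) u) (j.removeNth stdVec) := by
    refine setIntegral_eq_of_subset_of_forall_sdiff_eq_zero (hmeas 3) hcube fun u hu => ?_
    obtain ⟨k, hk⟩ : ∃ k, R < u k := by
      by_contra! h
      exact hu.2 ⟨hu.1, h⟩
    rw [hη0 _ (hzero _ (j.succAbove k) (by simpa using hk.le))]
    rfl
  -- The faces yⱼ = R lie off the support; only the faces yⱼ = 0 remain, entering with a minus sign,
  -- whence (-1)^(j+1).
  have hfront : ∀ u : Fin 3 → ℝ, f j (j.insertNth R u) = 0 := fun u => by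
    simp only [f]
    rw [hη0 _ (hzero _ j (by simp))]
    simp
  change _ = (∫ u in Set.Icc (0 : Fin 3 → ℝ) (fun _ => R), f j (j.insertNth R u)) -
    ∫ u in Set.Icc (0 : Fin 3 → ℝ) (fun _ => R), f j (j.insertNth 0 u)
  simp only [hfront, integral_zero, zero_sub, hface, f, integral_smul, pow_succ, mul_neg, mul_one,
    neg_smul]

/-! ### Pullback by corner charts -/

theorem form_four_apply_map (θ : Form 4) (A : Spacetime →L[ℝ] Spacetime) :
    θ (fun i => A (stdVec i)) = A.det • θ stdVec := by
  let e := Pi.basisFun ℝ (Fin 4)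
  have he : ⇑e = stdVec := by funext i; simp [e]
  have hθ : θ.toAlternatingMap =
      (LinearMap.toSpanSingleton ℝ B (θ stdVec)).compAlternatingMap e.det := by
    refine Module.Basis.ext_alternating e fun v hv => ?_
    let σ : Equiv.Perm (Fin 4) := Equiv.ofBijective v (Finite.injective_iff_bijective.1 hv)
    have hσ : (fun i => e (v i)) = e ∘ σ := by
      funext i; simp [σ]
    rw [hσ, AlternatingMap.map_perm, AlternatingMap.map_perm]
    have hdet := e.det_self
    rw [he] at hdet
    simp [he, hdet]
  have h := congrArg (fun φ => φ (A ∘ stdVec)) hθ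
  have hdet : e.det (A ∘ stdVec) = A.det := by
    rw [← he]
    refine (e.det_comp (A : Spacetime →ₗ[ℝ] Spacetime) e).trans ?_
    rw [e.det_self, mul_one]
  simp only [LinearMap.compAlternatingMap_apply, hdet] at h
  exact h

theorem continuous_extDeriv_apply {n : ℕ} {ω : Spacetime → Form n} (hω : ContDiff ℝ 1 ω)
    (v : Fin (n + 1) → Spacetime) : Continuous fun p => extDeriv ω p v :=
  (ContinuousAlternatingMap.apply ℝ Spacetime B v).continuous.comp <|
    (ContinuousAlternatingMap.alternatizeUncurryFinCLM ℝ Spacetime B).continuous.comp <|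
      hω.continuous_fderiv one_ne_zero

theorem extDeriv_of_notMem_tsupport {n : ℕ} {ω : Spacetime → Form n} {p : Spacetime}
    (hp : p ∉ tsupport ω) : extDeriv ω p = 0 := by
  rw [extDeriv, fderiv_of_notMem_tsupport ℝ hp]
  exact map_zero (ContinuousAlternatingMap.alternatizeUncurryFinCLM ℝ Spacetime B)

namespace CornerChart

variable {V : Set Spacetime} (c : CornerChart V)

theorem contDiffAt_symm {y : Spacetime} (hy : y ∈ c.chart.target) :
    ContDiffAt ℝ 2 c.chart.symm y :=
  c.contDiffOn_symm.contDiffAt (c.chart.open_target.mem_nhds hy)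

/-- By the chain rule the determinants of a chart and its inverse multiply to 1. Positivity removes
the absolute value in the change of variables. -/
theorem det_fderiv_symm_pos {y : Spacetime} (hy : y ∈ c.chart.target) :
    0 < (fderiv ℝ c.chart.symm y).det := by
  have hx := c.chart.map_target hy
  have hd : DifferentiableAt ℝ c.chart (c.chart.symm y) :=
    (c.contDiffOn.contDiffAt (c.chart.open_source.mem_nhds hx)).differentiableAt two_ne_zero
  have hcomp : HasFDerivAt (c.chart ∘ c.chart.symm)
      ((fderiv ℝ c.chart (c.chart.symm y)).comp (fderiv ℝ c.chart.symm y)) y :=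
    hd.hasFDerivAt.comp y ((c.contDiffAt_symm hy).differentiableAt two_ne_zero).hasFDerivAt
  have hid : HasFDerivAt (c.chart ∘ c.chart.symm) (ContinuousLinearMap.id ℝ Spacetime) y :=
    (hasFDerivAt_id y).congr_of_eventuallyEq <|
      Filter.eventuallyEq_of_mem (c.chart.open_target.mem_nhds hy) fun z hz => c.chart.right_inv hz
  have hdet : (fderiv ℝ c.chart (c.chart.symm y)).det * (fderiv ℝ c.chart.symm y).det = 1 := by
    have h := congrArg ContinuousLinearMap.det (hcomp.unique hid)
    simpa [ContinuousLinearMap.det, LinearMap.det_comp] using h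
  exact pos_of_mul_pos_right (hdet ▸ one_pos) (c.det_pos _ hx).le

theorem symm_image_corner :
    c.chart.symm '' ({y | ∀ j, 0 ≤ y j} ∩ c.chart.target) = V ∩ c.chart.source := by
  ext p
  constructor
  · rintro ⟨y, ⟨hy, hyt⟩, rfl⟩
    have hp := c.chart.map_target hyt
    exact ⟨(c.mem_iff _ hp).2 (by rwa [c.chart.right_inv hyt]), hp⟩
  · rintro ⟨hpV, hp⟩
    exact ⟨c.chart p, ⟨(c.mem_iff p hp).1 hpV, c.chart.map_source hp⟩, c.chart.left_inv hp⟩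

open Classical in
/-- The pullback of a form by the inverse of a chart, extended by zero. -/
def pullback {n : ℕ} (ω : Spacetime → Form n) (y : Spacetime) : Form n :=
  if y ∈ c.chart.target then
    (ω (c.chart.symm y)).compContinuousLinearMap (fderiv ℝ c.chart.symm y)
  else 0

theorem pullback_of_mem {n : ℕ} (ω : Spacetime → Form n) {y : Spacetime}
    (hy : y ∈ c.chart.target) : c.pullback ω y =
      (ω (c.chart.symm y)).compContinuousLinearMap (fderiv ℝ c.chart.symm y) :=
  if_pos hy

theorem pullbackCoeff_eq (ω : Spacetime → Form 3) (j : Fin 4) (y : Spacetime) :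
    pullbackCoeff c.chart ω j y = c.pullback ω y (j.removeNth stdVec) := by
  unfold pullbackCoeff pullback
  split_ifs <;> rfl

variable {c} {n : ℕ} {ω : Spacetime → Form n}

theorem isCompact_image_tsupport (hc : HasCompactSupport ω) (hs : tsupport ω ⊆ c.chart.source) :
    IsCompact (c.chart '' tsupport ω) :=
  hc.isCompact.image_of_continuousOn (c.chart.continuousOn.mono hs)

/-- The image of the compact support is compact, hence closed. So the extension by zero has no jump
at the edge of the chart's target. -/
theorem tsupport_pullback_subset (hc : HasCompactSupport ω) (hs : tsupport ω ⊆ c.chart.source) :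
    tsupport (c.pullback ω) ⊆ c.chart '' tsupport ω := by
  refine closure_minimal (fun y hy => ?_) (isCompact_image_tsupport hc hs).isClosed
  by_cases hyt : y ∈ c.chart.target
  · refine ⟨c.chart.symm y, subset_tsupport _ fun h0 => hy ?_, c.chart.right_inv hyt⟩
    rw [pullback_of_mem c ω hyt, h0]
    rfl
  · exact absurd (if_neg hyt) hy

theorem tsupport_pullback_subset_target (hc : HasCompactSupport ω)
    (hs : tsupport ω ⊆ c.chart.source) : tsupport (c.pullback ω) ⊆ c.chart.target :=
  (tsupport_pullback_subset hc hs).trans <|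
    Set.image_subset_iff.2 fun _ hp => c.chart.map_source (hs hp)

theorem hasCompactSupport_pullback (hc : HasCompactSupport ω) (hs : tsupport ω ⊆ c.chart.source) :
    HasCompactSupport (c.pullback ω) :=
  (isCompact_image_tsupport hc hs).of_isClosed_subset (isClosed_tsupport _)
    (tsupport_pullback_subset hc hs)

theorem pullback_eventuallyEq (ω : Spacetime → Form n) {y : Spacetime} (hy : y ∈ c.chart.target) :
    c.pullback ω =ᶠ[𝓝 y] fun z =>
      (ω (c.chart.symm z)).compContinuousLinearMap (fderiv ℝ c.chart.symm z) :=
  Filter.eventuallyEq_of_mem (c.chart.open_target.mem_nhds hy) fun _ hz => pullback_of_mem c ω hz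

theorem differentiable_pullback (hω : Differentiable ℝ ω) (hc : HasCompactSupport ω)
    (hs : tsupport ω ⊆ c.chart.source) : Differentiable ℝ (c.pullback ω) := by
  intro y
  by_cases hy : y ∈ tsupport (c.pullback ω)
  · have hyt := tsupport_pullback_subset_target hc hs hy
    have hsymm := c.contDiffAt_symm hyt
    -- The pullback contains the derivative of the inverse chart; differentiating it is where C²
    -- charts are used.
    refine DifferentiableAt.congr_of_eventuallyEq ?_ (pullback_eventuallyEq ω hyt)
    exact ((hω _).comp y (hsymm.differentiableAt
      two_ne_zero)).continuousAlternatingMapCompContinuousLinearMap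
      ((hsymm.fderiv_right (m := 1) (by norm_num)).differentiableAt one_ne_zero)
  · exact (HasFDerivAt.of_notMem_tsupport ℝ hy).differentiableAt

theorem extDeriv_pullback_of_mem (hω : Differentiable ℝ ω) {y : Spacetime}
    (hy : y ∈ c.chart.target) : extDeriv (c.pullback ω) y =
      (extDeriv ω (c.chart.symm y)).compContinuousLinearMap (fderiv ℝ c.chart.symm y) := by
  rw [(pullback_eventuallyEq ω hy).extDeriv_eq]
  exact extDeriv_pullback (hω _) (c.contDiffAt_symm hy) (by simp)

theorem extDeriv_pullback_apply_stdVec {ω : Spacetime → Form 3} (hω : Differentiable ℝ ω)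
    {y : Spacetime} (hy : y ∈ c.chart.target) : extDeriv (c.pullback ω) y stdVec =
      (fderiv ℝ c.chart.symm y).det • extDeriv ω (c.chart.symm y) stdVec := by
  rw [extDeriv_pullback_of_mem hω hy]
  exact form_four_apply_map _ _

/-- **Stokes' theorem** for a form supported in a corner chart. -/
theorem sum_faces_pullbackCoeff_eq {ω : Spacetime → Form 3} (hV : MeasurableSet V)
    (hω : ContDiff ℝ 1 ω) (hc : HasCompactSupport ω) (hs : tsupport ω ⊆ c.chart.source) :
    ∑ j : Fin 4, (-1 : ℝ) ^ ((j : ℕ) + 1) • ∫ u in {u : Fin 3 → ℝ | ∀ k, 0 ≤ u k},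
        pullbackCoeff c.chart ω j (j.insertNth (0 : ℝ) u) = ∫ p in V, extDeriv ω p stdVec := by
  have hd := hω.differentiable one_ne_zero
  -- On the target this function is the Jacobian determinant times dω along the inverse chart,
  -- visibly continuous; elsewhere it vanishes near each point.
  have hcont : Continuous fun y => extDeriv (c.pullback ω) y stdVec := by
    refine continuous_of_tsupport fun y hy => ?_
    have hsub : tsupport (fun y => extDeriv (c.pullback ω) y stdVec) ⊆ tsupport (c.pullback ω) := by
      refine closure_minimal (fun z hz => ?_) (isClosed_tsupport _)
      by_contra hz'
      exact hz (by simp [extDeriv_of_notMem_tsupport hz'])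
    have hyt := tsupport_pullback_subset_target hc hs (hsub hy)
    have hsymm := c.contDiffAt_symm hyt
    have hdet : ContinuousAt (fun y => (fderiv ℝ c.chart.symm y).det) y :=
      ContinuousLinearMap.continuous_det.continuousAt.comp
        (hsymm.continuousAt_fderiv two_ne_zero)
    refine (hdet.smul ((continuous_extDeriv_apply hω stdVec).continuousAt.comp
      hsymm.continuousAt)).congr ?_
    exact Filter.eventuallyEq_of_mem (c.chart.open_target.mem_nhds hyt) fun z hz =>
      (extDeriv_pullback_apply_stdVec hd hz).symm
  have hcorner : MeasurableSet {y : Spacetime | ∀ j, 0 ≤ y j} :=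
    (isClosed_Ici (a := (0 : Spacetime))).measurableSet
  have hs_meas := hcorner.inter c.chart.open_target.measurableSet
  simp only [pullbackCoeff_eq]
  rw [sum_faces_eq_integral_extDeriv (differentiable_pullback hd hc hs)
    (hasCompactSupport_pullback hc hs) hcont,
    setIntegral_eq_of_subset_of_forall_sdiff_eq_zero hcorner
      (Set.inter_subset_left (t := c.chart.target)) fun y hy => by
        rw [extDeriv_of_notMem_tsupport fun h =>
          hy.2 ⟨hy.1, tsupport_pullback_subset_target hc hs h⟩]
        rfl,
    setIntegral_eq_of_subset_of_forall_sdiff_eq_zero hV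
      (Set.inter_subset_left (t := c.chart.source)) fun p hp => by
        rw [extDeriv_of_notMem_tsupport fun h => hp.2 ⟨hp.1, hs h⟩]
        rfl,
    ← c.symm_image_corner,
    integral_image_eq_integral_abs_det_fderiv_smul volume hs_meas
      (fun y hy => ((c.contDiffAt_symm hy.2).differentiableAt
        two_ne_zero).hasFDerivAt.hasFDerivWithinAt)
      (c.chart.symm.injOn.mono Set.inter_subset_right)]
  refine setIntegral_congr_fun hs_meas fun y hy => ?_
  rw [extDeriv_pullback_apply_stdVec hd hy.2, abs_of_pos (c.det_fderiv_symm_pos hy.2)]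

end CornerChart

/-! ### Partitions of unity and cut-offs -/

theorem IsRegion.nonempty_regionAtlas {V : Set Spacetime} (hV : IsRegion V) :
    Nonempty (RegionAtlas V) := by
  choose c hc using hV.2
  obtain ⟨t, ht⟩ := hV.1.elim_nhds_subcover' (fun p hp => (c p hp).chart.source) fun p hp =>
    (c p hp).chart.open_source.mem_nhds (hc p hp)
  let e : Fin t.card ≃ t := t.equivFin.symm
  let d : Fin t.card → CornerChart V := fun i => c _ (e i : V).2
  have hcover : V ⊆ ⋃ i, (d i).chart.source := fun p hp => by
    obtain ⟨x, hx, hpx⟩ := Set.mem_iUnion₂.1 (ht hp)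
    exact Set.mem_iUnion.2 ⟨e.symm ⟨x, hx⟩, by simpa [d] using hpx⟩
  -- Partitioning over a compact neighbourhood L makes the sum equal 1 near V, not merely on V; the
  -- ball makes the supports compact.
  obtain ⟨L, hL, hVL, hLs⟩ := exists_compact_between hV.1
    (isOpen_iUnion fun i => (d i).chart.open_source) hcover
  obtain ⟨R, hR⟩ := hL.isBounded.subset_ball 0
  obtain ⟨f, hf⟩ := SmoothPartitionOfUnity.exists_isSubordinate (modelWithCornersSelf ℝ Spacetime)
    hL.isClosed (fun i => (d i).chart.source ∩ Metric.ball 0 R)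
    (fun i => (d i).chart.open_source.inter Metric.isOpen_ball)
    (by rw [← Set.iUnion_inter]; exact Set.subset_inter hLs hR)
  exact ⟨{
    N := t.card
    c := d
    ρ := fun i => f i
    contDiff := fun i => (f i).contMDiff.contDiff.of_le (by exact_mod_cast le_top)
    nonneg := fun i p => f.nonneg i p
    hasCompactSupport := fun i => (isCompact_closedBall (0 : Spacetime) R).of_isClosed_subset
      (isClosed_tsupport _) (((hf i).trans Set.inter_subset_right).trans Metric.ball_subset_closedBall)
    tsupport_subset := fun i => (hf i).trans Set.inter_subset_left
    sum_eq_one := by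
      filter_upwards [mem_nhdsSet_iff_exists.2 ⟨_, isOpen_interior, hVL, subset_rfl⟩] with p hp
      rw [← finsum_eq_sum_of_fintype]
      exact f.sum_eq_one (interior_subset hp) }⟩

/-- A cut-off equal to 1 near V and zero off a compact subset of U makes f globally C¹ without
changing its derivatives on V. -/
theorem exists_contDiff_eventuallyEq_nhdsSet {V U : Set Spacetime} {f : Spacetime → B}
    (hV : IsCompact V) (hU : IsOpen U) (hVU : V ⊆ U) (hf : ContDiffOn ℝ 1 f U) :
    ∃ g : Spacetime → B, ContDiff ℝ 1 g ∧ ∀ᶠ p in 𝓝ˢ V, g p = f p := by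
  obtain ⟨L, hL, hVL, hLU⟩ := exists_compact_between hV hU hVU
  obtain ⟨χ, hχ1, hχ0, -⟩ := exists_contMDiffMap_one_nhds_of_subset_interior (n := 1)
    (modelWithCornersSelf ℝ Spacetime) hV.isClosed hVL
  have hχ : ContDiff ℝ 1 χ := χ.contMDiff.contDiff
  refine ⟨fun p => χ p • f p, contDiff_iff_contDiffAt.2 fun p => ?_, ?_⟩
  · by_cases hp : p ∈ L
    · exact hχ.contDiffAt.smul (hf.contDiffAt (hU.mem_nhds (hLU hp)))
    · refine contDiffAt_const (c := (0 : B)) |>.congr_of_eventuallyEq ?_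
      filter_upwards [hL.isClosed.isOpen_compl.mem_nhds hp] with q hq
      rw [hχ0 q hq, zero_smul]
  · filter_upwards [hχ1] with p hp
    rw [hp, one_smul]

theorem extDeriv_fun_sum {n : ℕ} {ι : Type*} (s : Finset ι) {ω : ι → Spacetime → Form n}
    {p : Spacetime} (h : ∀ i ∈ s, DifferentiableAt ℝ (ω i) p) :
    extDeriv (fun p => ∑ i ∈ s, ω i p) p = ∑ i ∈ s, extDeriv (ω i) p := by
  simp only [extDeriv]
  rw [fderiv_fun_sum h]
  exact map_sum (ContinuousAlternatingMap.alternatizeUncurryFinCLM ℝ Spacetime B) _ _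

theorem pullbackCoeff_congr {V : Set Spacetime} (c : CornerChart V) {ω η : Spacetime → Form 3}
    (h : Set.EqOn ω η V) (j : Fin 4) {y : Spacetime} (hy : ∀ k, 0 ≤ y k) :
    pullbackCoeff c.chart ω j y = pullbackCoeff c.chart η j y := by
  unfold pullbackCoeff
  split_ifs with hyt
  · rw [h ((c.mem_iff _ (c.chart.map_target hyt)).2 (by rwa [c.chart.right_inv hyt]))]
  · rfl

/-! ### Global Stokes' theorem and the integral theorem -/

namespace RegionAtlas

variable {V : Set Spacetime} (A : RegionAtlas V)

theorem boundaryIntegral_congr {ω η : Spacetime → Form 3} (h : Set.EqOn ω η V) :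
    A.boundaryIntegral ω = A.boundaryIntegral η := by
  refine Finset.sum_congr rfl fun i _ => Finset.sum_congr rfl fun j _ => congrArg _ ?_
  refine setIntegral_congr_fun (isClosed_Ici (a := (0 : Fin 3 → ℝ))).measurableSet fun u hu => ?_
  refine pullbackCoeff_congr _ (fun p hp => congrArg (A.ρ i p • ·) (h hp)) j fun k => ?_
  refine Fin.succAboveCases j ?_ (fun l => ?_) k
  · simp
  · simpa using hu l

/-- **Stokes' theorem** for a compact domain with corners. -/
theorem boundaryIntegral_eq_integral_extDeriv {ω : Spacetime → Form 3} (hV : IsCompact V)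
    (hω : ContDiff ℝ 1 ω) : A.boundaryIntegral ω = ∫ p in V, extDeriv ω p stdVec := by
  have hωi : ∀ i, ContDiff ℝ 1 fun p => A.ρ i p • ω p := fun i => (A.contDiff i).smul hω
  have hsub : ∀ i, tsupport (fun p => A.ρ i p • ω p) ⊆ tsupport (A.ρ i) := fun i =>
    closure_mono fun p hp h0 => hp (by simp [h0])
  have hcomp : ∀ i, HasCompactSupport fun p => A.ρ i p • ω p := fun i =>
    (A.hasCompactSupport i).of_isClosed_subset (isClosed_tsupport _) (hsub i)
  have hlocal : A.boundaryIntegral ω =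
      ∑ i, ∫ p in V, extDeriv (fun p => A.ρ i p • ω p) p stdVec :=
    Finset.sum_congr rfl fun i _ => CornerChart.sum_faces_pullbackCoeff_eq hV.measurableSet (hωi i)
      (hcomp i) ((hsub i).trans (A.tsupport_subset i))
  rw [hlocal, ← integral_finsetSum _ fun i _ =>
    (continuous_extDeriv_apply (hωi i) stdVec).continuousOn.integrableOn_compact hV]
  refine setIntegral_congr_fun hV.measurableSet fun p hp => ?_
  -- Equality near p, not just at p, lets the sum be differentiated: the dρᵢ terms cancel.
  have hsum : (fun q => ∑ i, A.ρ i q • ω q) =ᶠ[𝓝 p] ω := by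
    filter_upwards [nhds_le_nhdsSet hp A.sum_eq_one] with q hq
    rw [← Finset.sum_smul, hq, one_smul]
  rw [← hsum.extDeriv_eq, extDeriv_fun_sum _ fun i _ => (hωi i).differentiable one_ne_zero p]
  exact (map_sum (ContinuousAlternatingMap.apply ℝ Spacetime B stdVec) _ _).symm

theorem boundaryIntegral_SH_eq_zero {U : Set Spacetime} {f : Spacetime → B} (hV : IsCompact V)
    (hU : IsOpen U) (hVU : V ⊆ U) (hf : ContDiffOn ℝ 1 f U) (hreg : IsBiregularOn f V) :
    A.boundaryIntegral (fun p => rmul SH (f p)) = 0 := by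
  obtain ⟨g, hg, hgf⟩ := exists_contDiff_eventuallyEq_nhdsSet hV hU hVU hf
  have hgf' : ∀ p ∈ V, g =ᶠ[𝓝 p] f := fun p hp => nhds_le_nhdsSet hp hgf
  rw [A.boundaryIntegral_congr (η := fun p => rmul SH (g p)) fun p hp =>
    congrArg (rmul SH) (hgf' p hp).eq_of_nhds.symm,
    A.boundaryIntegral_eq_integral_extDeriv (ω := fun p => rmul SH (g p)) hV
      ((rmulCLM SH).contDiff.comp hg)]
  refine setIntegral_eq_zero_of_forall_eq_zero fun p hp => ?_
  have hDH : DH g p = DH f p := by simp only [DH, pd, (hgf' p hp).fderiv_eq]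
  rw [extDeriv_rmul_SH (hg.differentiable one_ne_zero p), hDH, (hreg p hp).2]
  simp

end RegionAtlas

end Biquat

end

theorem mainTheorem6 :
    -- `S_H` is closed
    (∀ p, extDeriv (fun _ : Biquat.Spacetime => Biquat.SH) p = 0) ∧
    -- the exterior derivative `d(S_H f) = df ∧ S_H`, and the form `S_H ∧ df`
    (∀ (f : Biquat.Spacetime → Biquat.B) (p : Biquat.Spacetime), DifferentiableAt ℝ f p →
      extDeriv (fun p => Biquat.rmul Biquat.SH (f p)) p =
          Biquat.rmul Biquat.VH (Biquat.DH f p) ∧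
        Biquat.wedgeRight Biquat.SH (fderiv ℝ f p) =
          -Biquat.rmul Biquat.VH (Biquat.DH f p)) ∧
    -- biregularity is the existence of a "derivative" `g`
    (∀ (U : Set Biquat.Spacetime) (f : Biquat.Spacetime → Biquat.B), IsOpen U →
      DifferentiableOn ℝ f U →
      (Biquat.IsBiregularOn f U ↔
        ∃ g : Biquat.Spacetime → Biquat.B, ∀ p ∈ U,
          (1 / 2 : ℝ) • extDeriv (fun p => Biquat.rmul (Biquat.dqdq p) (f p)) p =
            Biquat.rmul Biquat.SH (g p))) ∧
    -- the integral theorem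
    (∀ (V U : Set Biquat.Spacetime) (f : Biquat.Spacetime → Biquat.B), Biquat.IsRegion V →
      IsOpen U → V ⊆ U → ContDiffOn ℝ 1 f U → Biquat.IsBiregularOn f V →
      Nonempty (Biquat.RegionAtlas V) ∧
        ∀ A : Biquat.RegionAtlas V,
          A.boundaryIntegral (fun p => Biquat.rmul Biquat.SH (f p)) = 0) := by

  refine ⟨fun p => ?_, fun f p hf => ⟨Biquat.extDeriv_rmul_SH hf, Biquat.wedgeRight_SH_fderiv f p⟩,
    fun U f hU hf => Biquat.isBiregularOn_iff_exists hU hf,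
    fun V U f hV hU hVU hf hreg => ⟨hV.nonempty_regionAtlas, fun A =>
      A.boundaryIntegral_SH_eq_zero hV.1 hU hVU hf hreg⟩⟩
  rw [extDeriv, fderiv_fun_const]
  exact map_zero (ContinuousAlternatingMap.alternatizeUncurryFinCLM ℝ Biquat.Spacetime Biquat.B)
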